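/- Let $\Gamma$ be a weighted digraph without loops on a finite vertex set $V$ with $n$ elements, with strictly positive arc weights; let $w_{ij}$ be the weight of the arc $(i,j)$, and $w_{ij}=0$ if there is no such arc. The Laplacian matrix $L=(\ell_{ij})_{i,j\in V}$ is given by $\ell_{ij}=-w_{ij}$ for $i\ne j$ and $\ell_{ii}=\sum_{k\ne i}w_{ik}$. A converging tree is a weakly connected digraph in which one vertex, the root, has outdegree $0$ and all other vertices have outdegree $1$; it is said to converge to its root. An in-forest of $\Gamma$ is a spanning subgraph of $\Gamma$ all of whose weak components are converging trees. The weight of an in-forest is the product of the weights of its arcs (and $1$ if it has no arcs), and the weight of a set of in-forests is the sum of the weights of its members. Let $\sigma$ be the total weight of all in-forests of $\Gamma$ and $\sigma_k$ the total weight of those with exactly $k$ arcs. Let $Q=(q_{ij})$, where $q_{ij}$ is the total weight of the in-forests in which $i$ belongs to a tree converging to $j$, and let $Q_k$ be the matrix defined in the same way with only the in-forests with exactly $k$ arcs. Let $d$ be the minimum number of trees in an in-forest of $\Gamma$, and put $\sigma(\tau)=\sum_{k=0}^{n-d}\sigma_k\tau^k$, $Q(\tau)=\sum_{k=0}^{n-d}Q_k\tau^k$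 (with $\tau^0=1$), $J=\sigma^{-1}Q$ and $J(\tau)=\sigma(\tau)^{-1}Q(\tau)$. Let $\operatorname{adj}A$ denote the transposed matrix of cofactors of $A$. (Theorem 3) $Q=\operatorname{adj}(I+L)$ and $\sigma=\det(I+L)$. Moreover $\sigma\neq0$, so that $I+L$ is invertible, and $J=(I+L)^{-1}$. (Theorem 3') For every $\tau\in\mathbb{R}$, $Q(\tau)=\operatorname{adj}(I+\tau L)$ and $\sigma(\tau)=\det(I+\tau L)$. Moreover, for every $\tau\ge0$, $\sigma(\tau)\neq0$, $I+\tau L$ is invertible, and $J(\tau)=(I+\tau L)^{-1}$. -/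

import Mathlib

/-! ### Digraphs, converging trees and converging forests -/

namespace Digraph

variable {V : Type*}

/-- The outdegree of a vertex: the number of arcs that come from it. -/
noncomputable def outdegree (H : Digraph V) (v : V) : ℕ∞ :=
  {u | H.Adj v u}.encard

/-- The subgraph of `H` induced on a set `S` of vertices. -/
def inducedOn (H : Digraph V) (S : Set V) : Digraph S where
  Adj u v := H.Adj u v

/-- `H` is a converging tree with root `r`: it is weakly connected (the corresponding undirected
graph is connected), `r` has outdegree zero and all other vertices have outdegree one. -/
def IsConvergingTree (H : Digraph V) (r : V) : Prop :=
  H.toSimpleGraphInclusive.Connected ∧ H.outdegree r = 0 ∧ ∀ v, v ≠ r → H.outdegree v = 1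

/-- The weak components of `H`. -/
abbrev WeakComponent (H : Digraph V) : Type _ :=
  H.toSimpleGraphInclusive.ConnectedComponent

/-- A converging forest: every weak component is a converging tree. -/
def IsConvergingForest (H : Digraph V) : Prop :=
  ∀ c : H.WeakComponent, ∃ r : c.supp, (H.inducedOn c.supp).IsConvergingTree r

/-- The vertex `i` belongs to a tree (a weak component of `H` which is a converging tree)
that converges to `j`. -/
def InTreeConvergingTo (H : Digraph V) (i j : V) : Prop :=
  ∃ (c : H.WeakComponent) (hj : j ∈ c.supp),
    i ∈ c.supp ∧ (H.inducedOn c.supp).IsConvergingTree ⟨j, hj⟩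

open Classical in
/-- The finite set of arcs of a digraph on a finite vertex set. -/
noncomputable def arcs [Fintype V] (H : Digraph V) : Finset (V × V) :=
  Finset.univ.filter fun e => H.Adj e.1 e.2

/-- The number of trees of a converging forest is the number of its weak components. -/
noncomputable def numTrees (H : Digraph V) : ℕ :=
  Nat.card H.WeakComponent

end Digraph

/-- A weighted digraph without loops: the matrix `weight` of arc weights has a strictly positive
entry at every arc and a zero entry at every pair which is not an arc. -/
structure WeightedDigraph (V : Type*) extends Digraph V where
  /-- The matrix of arc weights. -/
  weight : V → V → ℝ
  not_adj_self : ∀ v, ¬ Adj v v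
  weight_pos : ∀ u v, Adj u v → 0 < weight u v
  weight_eq_zero : ∀ u v, ¬ Adj u v → weight u v = 0

namespace WeightedDigraph

variable {V : Type*} [Fintype V]

/-- The weight of a spanning subgraph: the product of the weights of its arcs. -/
noncomputable def subgraphWeight (Γ : WeightedDigraph V) (H : Digraph V) : ℝ :=
  ∏ e ∈ H.arcs, Γ.weight e.1 e.2

open Classical in
/-- The weight of a set of spanning subgraphs: the sum of the weights of its members. -/
noncomputable def setWeight (Γ : WeightedDigraph V) (𝒢 : Set (Digraph V)) : ℝ :=
  ∑ H : Digraph V with H ∈ 𝒢, Γ.subgraphWeight H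

/-- The set of all in-forests (spanning converging forests) of `Γ`. -/
def inForests (Γ : WeightedDigraph V) : Set (Digraph V) :=
  {F | F ≤ Γ.toDigraph ∧ F.IsConvergingForest}

/-- The set of all in-forests of `Γ` with `k` arcs. -/
def inForestsCard (Γ : WeightedDigraph V) (k : ℕ) : Set (Digraph V) :=
  {F ∈ Γ.inForests | F.arcs.card = k}

/-- The set of all in-forests of `Γ` where `i` belongs to a tree converging to `j`. -/
def inForestsTo (Γ : WeightedDigraph V) (i j : V) : Set (Digraph V) :=
  {F ∈ Γ.inForests | F.InTreeConvergingTo i j}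

/-- The set of all in-forests of `Γ` with `k` arcs where `i` belongs to a tree converging
to `j`. -/
def inForestsCardTo (Γ : WeightedDigraph V) (k : ℕ) (i j : V) : Set (Digraph V) :=
  {F ∈ Γ.inForestsCard k | F.InTreeConvergingTo i j}

/-- The in-forest dimension `d` of `Γ`: the minimum possible number of trees in an in-forest. -/
noncomputable def inForestDim (Γ : WeightedDigraph V) : ℕ :=
  sInf (Digraph.numTrees '' Γ.inForests)

/-- `σ_k`, the total weight of in-forests with `k` arcs. -/
noncomputable def sigmaK (Γ : WeightedDigraph V) (k : ℕ) : ℝ :=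
  Γ.setWeight (Γ.inForestsCard k)

/-- `σ`, the total weight of in-forests. -/
noncomputable def sigma (Γ : WeightedDigraph V) : ℝ :=
  Γ.setWeight Γ.inForests

/-- `σ(τ) = ∑_{k=0}^{n-d} σ_k τ^k`. -/
noncomputable def sigmaParam (Γ : WeightedDigraph V) (τ : ℝ) : ℝ :=
  ∑ k ∈ Finset.range (Fintype.card V - Γ.inForestDim + 1), Γ.sigmaK k * τ ^ k

/-- `Q_k`, the matrix of in-forests with `k` arcs. -/
noncomputable def QK (Γ : WeightedDigraph V) (k : ℕ) : Matrix V V ℝ :=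
  Matrix.of fun i j => Γ.setWeight (Γ.inForestsCardTo k i j)

/-- `Q`, the matrix of all in-forests. -/
noncomputable def Q (Γ : WeightedDigraph V) : Matrix V V ℝ :=
  Matrix.of fun i j => Γ.setWeight (Γ.inForestsTo i j)

/-- `Q(τ) = ∑_{k=0}^{n-d} Q_k τ^k`. -/
noncomputable def QParam (Γ : WeightedDigraph V) (τ : ℝ) : Matrix V V ℝ :=
  ∑ k ∈ Finset.range (Fintype.card V - Γ.inForestDim + 1), τ ^ k • Γ.QK k

/-- `J = σ⁻¹ Q`, the normalized matrix of all in-forests. -/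
noncomputable def J (Γ : WeightedDigraph V) : Matrix V V ℝ :=
  Γ.sigma⁻¹ • Γ.Q

/-- `J(τ) = σ(τ)⁻¹ Q(τ)`. -/
noncomputable def JParam (Γ : WeightedDigraph V) (τ : ℝ) : Matrix V V ℝ :=
  (Γ.sigmaParam τ)⁻¹ • Γ.QParam τ

/-- The (row) Laplacian matrix: the off-diagonal entries are `-w_{ij}`, and the diagonal entries
make the row sums zero. -/
def laplacian [DecidableEq V] (Γ : WeightedDigraph V) : Matrix V V ℝ :=
  Matrix.of fun i j => if i = j then ∑ k ∈ Finset.univ.erase i, Γ.weight i k else -Γ.weight i j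

end WeightedDigraph

/-! Row `i` of `I + τL` is `e_i + ∑_k τ w_ik (e_i - e_k)`: a weighted sum over the ways to leave `i`
without a successor or to give it a successor `k`. By multilinearity (`det_sum_successorRow`,
`adjugate_sum_successorRow`) determinant and cofactors become sums over partial successor maps `f`,
weighted by the product of the choices, of the same quantity for the 0, ±1 matrix `successorMatrix
f`.

That determinant is 1 if all paths of `f` end and 0 otherwise; if `f j = none`, entry `(i, j)` of
the adjugate is 1 when moreover the path of `i` ends at `j`, else 0. Terminating maps are exactly
the converging forests (`IsConvergingForest.exists_ofSuccessor`), so the sums are `σ(τ)` and `Q(τ)`.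
The inverse follows from `σ(τ) > 0` for `τ ≥ 0`. -/

/-! ### Successor maps -/

/-- A partial successor map `f` leads from `u` to `v` if iterating `f` from `u` reaches `v`. -/
def LeadsTo {V : Type*} (f : V → Option V) : V → V → Prop :=
  Relation.ReflTransGen fun u v => f u = some v

/-- A partial successor map terminates if it leads from every point to a point without successor. -/
def Terminates {V : Type*} (f : V → Option V) : Prop :=
  ∀ v, ∃ r, LeadsTo f v r ∧ f r = none

section SuccessorMaps

variable {V : Type*} {f : V → Option V}

theorem LeadsTo.iff_of_eq_some {u v r : V} (h : f u = some v) (hr : f r = none) :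
    LeadsTo f u r ↔ LeadsTo f v r := by
  refine ⟨fun hu => ?_, fun hv => Relation.ReflTransGen.head h hv⟩
  rcases Relation.ReflTransGen.cases_head hu with rfl | ⟨w, hw, hwr⟩
  · rw [hr] at h
    cases h
  · rw [h] at hw
    cases hw
    exact hwr

theorem LeadsTo.eq_of_eq_none {u r : V} (h : f u = none) (hur : LeadsTo f u r) : u = r := by
  rcases Relation.ReflTransGen.cases_head hur with rfl | ⟨w, hw, -⟩
  · rfl
  · rw [h] at hw
    cases hw

/-- A vertex without successor is trivially accessible, and accessibility passes back along a path
because successors are unique. -/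
theorem Terminates.wellFounded (hf : Terminates f) :
    WellFounded fun v u => f u = some v := by
  refine ⟨fun u => ?_⟩
  obtain ⟨r, hur, hr⟩ := hf u
  induction hur using Relation.ReflTransGen.head_induction_on with
  | refl =>
    refine ⟨_, fun y hy => ?_⟩
    rw [hr] at hy
    cases hy
  | head h _ ih =>
    refine ⟨_, fun y hy => ?_⟩
    rw [h] at hy
    cases hy
    exact ih

end SuccessorMaps

/-! ### The Laplacian of a successor map -/

section SuccessorMatrix

open Matrix

variable {V : Type*} [Fintype V] [DecidableEq V]

/-- The row that belongs to the vertex `i` and to its prospective successor. -/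
def successorRow (i : V) : Option V → V → ℝ
  | none => Pi.single i 1
  | some k => Pi.single i 1 - Pi.single k 1

/-- The matrix `I + L` of the graph of a successor map with unit weights. -/
def successorMatrix (f : V → Option V) : Matrix V V ℝ :=
  Matrix.of fun i => successorRow i (f i)

theorem successorRow_none_dotProduct (i : V) (x : V → ℝ) :
    successorRow i none ⬝ᵥ x = x i := by
  simp [successorRow]

theorem successorRow_some_dotProduct (i k : V) (x : V → ℝ) :
    successorRow i (some k) ⬝ᵥ x = x i - x k := by
  simp [successorRow, sub_dotProduct]

/-- Arcs strictly lower the well-founded rank, so ordering the vertices by rank makes the matrix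
unitriangular. -/
theorem det_successorMatrix_of_terminates {f : V → Option V} (hf : Terminates f) :
    (successorMatrix f).det = 1 := by
  have : IsWellFounded V fun v u => f u = some v := ⟨hf.wellFounded⟩
  -- The order is reversed because `BlockTriangular` wants zeros where `b j < b i`, while arcs go to
  -- smaller rank.
  set b : V → Ordinalᵒᵈ := fun v =>
    OrderDual.toDual (IsWellFounded.rank (fun v u => f u = some v) v) with hb
  have key : ∀ i j, b j ≤ b i → successorMatrix f i j = if i = j then 1 else 0 := by
    intro i j hij
    cases hi : f i with
    | none => simp [successorMatrix, successorRow, hi, Pi.single_apply, eq_comm]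
    | some k =>
      have hk : b i < b k :=
        OrderDual.toDual_lt_toDual.2
          (IsWellFounded.rank_lt_of_rel (r := fun v u => f u = some v) hi)
      have hjk : j ≠ k := by
        rintro rfl
        exact absurd hk (not_lt.2 hij)
      simp [successorMatrix, successorRow, hi, Pi.single_apply, hjk, eq_comm]
  have hT : (successorMatrix f).BlockTriangular b := by
    intro i j hij
    rw [key i j hij.le, if_neg]
    rintro rfl
    exact lt_irrefl _ hij
  rw [hT.det]
  refine Finset.prod_eq_one fun a _ => ?_
  have : (successorMatrix f).toSquareBlock b a = 1 := by
    ext i j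
    rw [toSquareBlock_def, of_apply, key _ _ (by rw [i.2, j.2]), one_apply]
    simp [Subtype.ext_iff]
  rw [this, det_one]

/-- The indicator of the vertices whose path never ends is constant along arcs and zero at ends of
paths, hence a nonzero kernel vector. -/
theorem det_successorMatrix_of_not_terminates {f : V → Option V} (hf : ¬ Terminates f) :
    (successorMatrix f).det = 0 := by
  classical
  obtain ⟨v, hv⟩ := not_forall.1 hf
  rw [← exists_mulVec_eq_zero_iff]
  refine ⟨fun u => if ∃ r, LeadsTo f u r ∧ f r = none then 0 else 1, fun h => ?_, ?_⟩
  · have := congrFun h v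
    simp [hv] at this
  · ext i
    change successorRow i (f i) ⬝ᵥ _ = 0
    cases hi : f i with
    | none =>
      rw [successorRow_none_dotProduct, if_pos ⟨i, Relation.ReflTransGen.refl, hi⟩]
    | some k =>
      rw [successorRow_some_dotProduct, sub_eq_zero]
      have : (∃ r, LeadsTo f i r ∧ f r = none) ↔ ∃ r, LeadsTo f k r ∧ f r = none :=
        exists_congr fun r => and_congr_left fun hr => LeadsTo.iff_of_eq_some hi hr
      simp only [this]

open Classical in
theorem det_successorMatrix (f : V → Option V) :
    (successorMatrix f).det = if Terminates f then 1 else 0 := by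
  split_ifs with h
  · exact det_successorMatrix_of_terminates h
  · exact det_successorMatrix_of_not_terminates h

open Classical in
-- The indicator `x` of the vertices leading to `j` solves `M x = e_j`. Multiplying by `adj M` gives
-- column `j` as `det M • x`, even for singular `M`.
theorem adjugate_successorMatrix {f : V → Option V} (i : V) {j : V} (hj : f j = none) :
    (successorMatrix f).adjugate i j = if Terminates f ∧ LeadsTo f i j then 1 else 0 := by
  set x : V → ℝ := fun u => if LeadsTo f u j then 1 else 0 with hx
  have hmul : successorMatrix f *ᵥ x = Pi.single j 1 := by
    ext u
    change successorRow u (f u) ⬝ᵥ _ = _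
    cases hu : f u with
    | none =>
      rw [successorRow_none_dotProduct, Pi.single_apply, hx]
      refine if_congr ⟨LeadsTo.eq_of_eq_none hu, ?_⟩ rfl rfl
      rintro rfl
      exact Relation.ReflTransGen.refl
    | some k =>
      have huj : u ≠ j := by
        rintro rfl
        rw [hu] at hj
        cases hj
      rw [successorRow_some_dotProduct, Pi.single_eq_of_ne huj, sub_eq_zero, hx]
      exact if_congr (LeadsTo.iff_of_eq_some hu hj) rfl rfl
  have h1 : (successorMatrix f).adjugate *ᵥ (Pi.single j 1) = (successorMatrix f).det • x := by
    rw [← hmul, mulVec_mulVec, adjugate_mul, smul_mulVec, one_mulVec]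
  have h2 := congrFun h1 i
  rw [mulVec_single_one, col_apply, det_successorMatrix, Pi.smul_apply, smul_eq_mul, hx] at h2
  rw [h2, ite_and, ite_mul, one_mul, zero_mul]

/-- Expansion of a determinant whose rows are combinations of successor rows. -/
theorem det_sum_successorRow (c : V → Option V → ℝ) :
    (Matrix.of fun i => ∑ o, c i o • successorRow i o).det =
      ∑ f : V → Option V, (∏ i, c i (f i)) * (successorMatrix f).det := by
  have h := (detRowAlternating (n := V) (R := ℝ)).toMultilinearMap.map_sum
    (fun i o => c i o • successorRow i o)
  refine h.trans (Finset.sum_congr rfl fun f _ => ?_)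
  exact (detRowAlternating (n := V) (R := ℝ)).toMultilinearMap.map_smul_univ _ _

/-- Expansion of a cofactor of a matrix whose rows are combinations of successor rows. -/
theorem adjugate_sum_successorRow (c : V → Option V → ℝ) (i j : V) (hc : c j none = 1) :
    (Matrix.of fun i => ∑ o, c i o • successorRow i o).adjugate i j =
      ∑ f : V → Option V with f j = none,
        (∏ i, c i (f i)) * (successorMatrix f).adjugate i j := by
  -- The cofactor replaces row `j` by `e_i`. Writing `e_i` as a sum over all choices, with
  -- coefficient 1 at `none` and 0 elsewhere, leaves only maps with `f j = none`.
  have h := (detRowAlternating (n := V) (R := ℝ)).toMultilinearMap.map_sum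
    (fun u o => (if u = j then (if o = none then 1 else 0) else c u o) •
      (if u = j then Pi.single i 1 else successorRow u o))
  rw [adjugate_apply, Finset.sum_filter]
  refine Eq.trans ?_ (h.trans (Finset.sum_congr rfl fun f _ => ?_))
  · change det _ = det _
    congr 1
    ext u v
    by_cases hu : u = j
    · subst hu
      simp
    · simp [hu, updateRow_ne]
  · refine ((detRowAlternating (n := V) (R := ℝ)).toMultilinearMap.map_smul_univ _ _).trans ?_
    split_ifs with hf
    · rw [smul_eq_mul, adjugate_apply]
      congr 1
      · refine Finset.prod_congr rfl fun u _ => ?_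
        split_ifs with hu
        · rw [hu, hf, hc]
        · simp_all
        · rfl
      · change det _ = det _
        congr 1
        ext u v
        by_cases hu : u = j
        · subst hu
          simp
        · simp [hu, updateRow_ne, successorMatrix]
    · rw [Finset.prod_eq_zero (Finset.mem_univ j), zero_smul]
      simp [hf]

end SuccessorMatrix

/-! ### Converging forests as graphs of terminating successor maps -/

namespace Digraph

variable {V : Type*}

/-- The graph of a partial successor map. -/
def ofSuccessor (f : V → Option V) : Digraph V where
  Adj u v := f u = some v

theorem ofSuccessor_adj {f : V → Option V} {u v : V} : (ofSuccessor f).Adj u v ↔ f u = some v :=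
  Iff.rfl

theorem ofSuccessor_injective : Function.Injective (ofSuccessor (V := V)) := by
  intro f g h
  funext u
  have h' : ∀ v, f u = some v ↔ g u = some v := fun v => by
    rw [← ofSuccessor_adj, h, ofSuccessor_adj]
  exact Option.ext h'

/-- Vertices of one weak component cannot be separated by an arc-invariant predicate. -/
theorem iff_of_reachable {H : Digraph V} {p : V → Prop}
    (hp : ∀ u v, H.Adj u v → (p u ↔ p v)) {u v : V}
    (h : H.toSimpleGraphInclusive.Reachable u v) : p u ↔ p v := by
  obtain ⟨w⟩ := h
  induction w with
  | nil => rfl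
  | cons hadj _ ih =>
    refine Iff.trans ?_ ih
    rcases hadj.2 with h | h
    · exact hp _ _ h
    · exact (hp _ _ h).symm

theorem reachable_of_adj {H : Digraph V} {u v : V} (h : H.Adj u v) :
    H.toSimpleGraphInclusive.Reachable u v := by
  by_cases huv : u = v
  · rw [huv]
  · exact SimpleGraph.Adj.reachable ⟨huv, Or.inl h⟩

theorem mem_supp_of_adj {H : Digraph V} {c : H.WeakComponent} {u v : V} (h : H.Adj u v)
    (hu : u ∈ c.supp) : v ∈ c.supp := by
  rw [SimpleGraph.ConnectedComponent.mem_supp_iff] at hu ⊢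
  rw [← hu]
  exact SimpleGraph.ConnectedComponent.sound (reachable_of_adj h).symm

theorem reachable_of_leadsTo {f : V → Option V} {u v : V} (h : LeadsTo f u v) :
    (ofSuccessor f).toSimpleGraphInclusive.Reachable u v := by
  induction h with
  | refl => rfl
  | tail _ h ih => exact ih.trans (reachable_of_adj h)

theorem inducedOn_supp_connected {H : Digraph V} (c : H.WeakComponent) :
    (H.inducedOn c.supp).toSimpleGraphInclusive.Connected := by
  have h : (H.inducedOn c.supp).toSimpleGraphInclusive = c.toSimpleGraph := by
    ext u v
    change (u ≠ v ∧ _) ↔ ((u : V) ≠ v ∧ _)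
    rw [Ne, Ne, Subtype.ext_iff]
    rfl
  rw [h]
  exact c.connected_toSimpleGraph

/-- A component of the graph of a successor map that contains a vertex without successor is a
tree converging to that vertex. -/
theorem isConvergingTree_ofSuccessor {f : V → Option V} {r : V} (hr : f r = none)
    {c : (ofSuccessor f).WeakComponent} (hc : r ∈ c.supp) :
    ((ofSuccessor f).inducedOn c.supp).IsConvergingTree ⟨r, hc⟩ := by
  refine ⟨inducedOn_supp_connected c, ?_, ?_⟩
  · rw [outdegree, Set.encard_eq_zero, Set.eq_empty_iff_forall_notMem]
    intro u hu
    have : f r = some u := hu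
    rw [hr] at this
    cases this
  · rintro ⟨v, hv⟩ hvr
    have hreach : (ofSuccessor f).toSimpleGraphInclusive.Reachable v r :=
      SimpleGraph.ConnectedComponent.exact (hv.trans hc.symm)
    -- Leading to `r` is invariant along arcs in both directions, since `r` has no successor; this
    -- turns weak connection into a directed path.
    have hlead : LeadsTo f v r :=
      (iff_of_reachable (p := fun u => LeadsTo f u r)
        (fun u w huw => LeadsTo.iff_of_eq_some huw hr) hreach).2 Relation.ReflTransGen.refl
    cases hfv : f v with
    | none => exact absurd (Subtype.ext (LeadsTo.eq_of_eq_none hfv hlead)) hvr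
    | some w =>
      rw [outdegree, Set.encard_eq_one]
      refine ⟨⟨w, mem_supp_of_adj (H := ofSuccessor f) hfv hv⟩, ?_⟩
      ext u
      change f v = some u.1 ↔ u = _
      rw [hfv, Option.some_inj, Subtype.ext_iff, eq_comm]

theorem isConvergingForest_ofSuccessor {f : V → Option V} (hf : Terminates f) :
    (ofSuccessor f).IsConvergingForest := by
  intro c
  induction c using SimpleGraph.ConnectedComponent.ind with
  | h v =>
    obtain ⟨r, hvr, hr⟩ := hf v
    have hc : r ∈ ((ofSuccessor f).toSimpleGraphInclusive.connectedComponentMk v).supp :=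
      SimpleGraph.ConnectedComponent.sound (reachable_of_leadsTo hvr).symm
    exact ⟨⟨r, hc⟩, isConvergingTree_ofSuccessor hr hc⟩

theorem eq_none_of_isConvergingTree {f : V → Option V} {c : (ofSuccessor f).WeakComponent}
    {r : c.supp} (h : ((ofSuccessor f).inducedOn c.supp).IsConvergingTree r) : f r = none := by
  cases hr : f r with
  | none => rfl
  | some w =>
    have h0 := h.2.1
    rw [outdegree, Set.encard_eq_zero, Set.eq_empty_iff_forall_notMem] at h0
    exact absurd hr (h0 ⟨w, mem_supp_of_adj (H := ofSuccessor f) hr r.2⟩)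

theorem leadsTo_of_isConvergingTree {f : V → Option V} {c : (ofSuccessor f).WeakComponent}
    {r : c.supp} (h : ((ofSuccessor f).inducedOn c.supp).IsConvergingTree r) {v : V}
    (hv : v ∈ c.supp) : LeadsTo f v r := by
  have hr := eq_none_of_isConvergingTree h
  have hreach : (ofSuccessor f).toSimpleGraphInclusive.Reachable v r :=
    SimpleGraph.ConnectedComponent.exact (hv.trans r.2.symm)
  exact (iff_of_reachable (p := fun u => LeadsTo f u r)
    (fun u w huw => LeadsTo.iff_of_eq_some huw hr) hreach).2 Relation.ReflTransGen.refl

theorem inTreeConvergingTo_ofSuccessor {f : V → Option V} {i j : V} :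
    (ofSuccessor f).InTreeConvergingTo i j ↔ f j = none ∧ LeadsTo f i j := by
  constructor
  · rintro ⟨c, hj, hi, h⟩
    exact ⟨eq_none_of_isConvergingTree h, leadsTo_of_isConvergingTree h hi⟩
  · rintro ⟨hj, hij⟩
    have hc : j ∈ ((ofSuccessor f).toSimpleGraphInclusive.connectedComponentMk i).supp :=
      SimpleGraph.ConnectedComponent.sound (reachable_of_leadsTo hij).symm
    exact ⟨_, hc, rfl, isConvergingTree_ofSuccessor hj hc⟩

/-- Arcs never leave a weak component, so the outdegree bound inside the tree of `u` holds in `H`.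
-/
theorem IsConvergingForest.adj_unique {H : Digraph V} (hH : H.IsConvergingForest) {u v w : V}
    (hv : H.Adj u v) (hw : H.Adj u w) : v = w := by
  have hu : u ∈ (H.toSimpleGraphInclusive.connectedComponentMk u).supp := rfl
  obtain ⟨r, -, h0, h1⟩ := hH (H.toSimpleGraphInclusive.connectedComponentMk u)
  have hle : (H.inducedOn _).outdegree ⟨u, hu⟩ ≤ 1 := by
    by_cases hur : ⟨u, hu⟩ = r
    · rw [hur, h0]
      exact zero_le_one
    · rw [h1 _ hur]
  have := Set.encard_le_one_iff.1 hle ⟨v, mem_supp_of_adj hv hu⟩ ⟨w, mem_supp_of_adj hw hu⟩ hv hw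
  exact Subtype.ext_iff.1 this

theorem IsConvergingForest.exists_ofSuccessor {H : Digraph V} (hH : H.IsConvergingForest) :
    ∃ f : V → Option V, Terminates f ∧ ofSuccessor f = H := by
  classical
  obtain ⟨f, hf⟩ : ∃ f : V → Option V, ∀ u v, f u = some v ↔ H.Adj u v := by
    have : ∀ u, ∃ o : Option V, ∀ v, o = some v ↔ H.Adj u v := by
      intro u
      by_cases hu : ∃ v, H.Adj u v
      · obtain ⟨v, hv⟩ := hu
        refine ⟨some v, fun w => ⟨fun h => ?_, fun h => ?_⟩⟩
        · cases h
          exact hv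
        · rw [hH.adj_unique hv h]
      · refine ⟨none, fun w => ⟨fun h => ?_, fun h => absurd ⟨w, h⟩ hu⟩⟩
        cases h
    exact ⟨fun u => (this u).choose, fun u => (this u).choose_spec⟩
  obtain rfl : ofSuccessor f = H := by
    ext u v
    exact hf u v
  refine ⟨f, fun v => ?_, rfl⟩
  obtain ⟨r, hr⟩ := hH ((ofSuccessor f).toSimpleGraphInclusive.connectedComponentMk v)
  exact ⟨r, leadsTo_of_isConvergingTree hr rfl, eq_none_of_isConvergingTree hr⟩

variable [Fintype V]

open Classical in
theorem prod_arcs_ofSuccessor {M : Type*} [CommMonoid M] (f : V → Option V) (w : V → V → M) :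
    ∏ e ∈ (ofSuccessor f).arcs, w e.1 e.2 = ∏ v, (f v).elim 1 (w v) := by
  rw [arcs, Finset.prod_filter, Fintype.prod_prod_type]
  refine Finset.prod_congr rfl fun v _ => ?_
  simp only [ofSuccessor_adj]
  cases f v <;> simp

open Classical in
theorem card_arcs_ofSuccessor (f : V → Option V) :
    (ofSuccessor f).arcs.card = (Finset.univ.filter fun v => f v ≠ none).card := by
  -- Counting arcs is the product formula with every weight equal to 1 in multiplicative notation.
  have h := prod_arcs_ofSuccessor f fun _ _ => Multiplicative.ofAdd 1
  rw [Finset.card_eq_sum_ones, Finset.card_filter]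
  refine (congrArg Multiplicative.toAdd h).trans ?_
  rw [toAdd_prod]
  refine Finset.sum_congr rfl fun v _ => ?_
  cases f v <;> simp

/-- A converging forest with `m` trees has at most `n - m` arcs. -/
theorem IsConvergingForest.card_arcs_add_numTrees_le {H : Digraph V}
    (hH : H.IsConvergingForest) : H.arcs.card + H.numTrees ≤ Fintype.card V := by
  classical
  obtain ⟨f, hf, rfl⟩ := hH.exists_ofSuccessor
  have hle : (ofSuccessor f).numTrees ≤ (Finset.univ.filter fun v => ¬ f v ≠ none).card := by
    rw [numTrees, ← Fintype.card_subtype, ← Nat.card_eq_fintype_card]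
    -- Every tree contains a root, so there are at most as many trees as vertices without successor.
    refine Nat.card_le_card_of_surjective
      (fun r : {v // ¬ f v ≠ none} =>
        (ofSuccessor f).toSimpleGraphInclusive.connectedComponentMk r) fun c => ?_
    obtain ⟨r, hr⟩ := isConvergingForest_ofSuccessor hf c
    exact ⟨⟨r, not_not.2 (eq_none_of_isConvergingTree hr)⟩, r.2⟩
  rw [card_arcs_ofSuccessor, ← Finset.card_univ,
    ← Finset.card_filter_add_card_filter_not (s := Finset.univ) fun v => f v ≠ none]
  exact Nat.add_le_add_left hle _

end Digraph

/-! ### Generating functions of in-forests -/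

namespace WeightedDigraph

variable {V : Type*} [Fintype V]

/-- The weight of having `k` as the successor of `i`, with arc weights multiplied by `τ`. -/
def successorWeight (Γ : WeightedDigraph V) (τ : ℝ) (i : V) (o : Option V) : ℝ :=
  o.elim 1 fun k => τ * Γ.weight i k

theorem prod_successorWeight (Γ : WeightedDigraph V) (τ : ℝ) (f : V → Option V) :
    ∏ i, Γ.successorWeight τ i (f i) =
      Γ.subgraphWeight (Digraph.ofSuccessor f) * τ ^ (Digraph.ofSuccessor f).arcs.card := by
  rw [subgraphWeight, mul_comm, ← Finset.prod_const, ← Finset.prod_mul_distrib,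
    Digraph.prod_arcs_ofSuccessor f fun i k => τ * Γ.weight i k]
  rfl

theorem subgraphWeight_eq_zero (Γ : WeightedDigraph V) {H : Digraph V}
    (h : ¬ H ≤ Γ.toDigraph) : Γ.subgraphWeight H = 0 := by
  have : ∃ u v, H.Adj u v ∧ ¬ Γ.Adj u v := by
    by_contra! h'
    exact h fun u v => h' u v
  obtain ⟨u, v, huv, hΓ⟩ := this
  refine Finset.prod_eq_zero (i := (u, v)) ?_ (Γ.weight_eq_zero u v hΓ)
  simpa [Digraph.arcs] using huv

theorem subgraphWeight_pos (Γ : WeightedDigraph V) {H : Digraph V}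
    (h : H ≤ Γ.toDigraph) : 0 < Γ.subgraphWeight H := by
  refine Finset.prod_pos fun e he => Γ.weight_pos _ _ (h ?_)
  simpa [Digraph.arcs] using he

open Classical in
/-- Sums over in-forests are sums over terminating successor maps. -/
theorem sum_inForests_eq (Γ : WeightedDigraph V) (τ : ℝ) {𝒢 : Set (Digraph V)}
    {P : Digraph V → Prop} (h𝒢 : ∀ F, F ∈ 𝒢 ↔ F ∈ Γ.inForests ∧ P F) :
    ∑ H : Digraph V with H ∈ 𝒢, Γ.subgraphWeight H * τ ^ H.arcs.card =
      ∑ f : V → Option V with Terminates f ∧ P (Digraph.ofSuccessor f),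
        ∏ i, Γ.successorWeight τ i (f i) := by
  symm
  -- Maps that use a non-arc of `Γ` have weight zero, so only nonzero terms need to correspond.
  refine Finset.sum_bij_ne_zero (fun f _ _ => Digraph.ofSuccessor f) ?_ ?_ ?_ ?_
  · intro f hf hne
    rw [Finset.mem_filter] at hf ⊢
    rw [h𝒢]
    rw [prod_successorWeight] at hne
    refine ⟨Finset.mem_univ _, ⟨?_, Digraph.isConvergingForest_ofSuccessor hf.2.1⟩, hf.2.2⟩
    by_contra h
    exact left_ne_zero_of_mul hne (Γ.subgraphWeight_eq_zero h)
  · intro f _ _ g _ _ h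
    exact Digraph.ofSuccessor_injective h
  · intro H hH hne
    rw [Finset.mem_filter, h𝒢] at hH
    obtain ⟨f, hf, rfl⟩ := hH.2.1.2.exists_ofSuccessor
    refine ⟨f, ?_, ?_, rfl⟩
    · rw [Finset.mem_filter]
      exact ⟨Finset.mem_univ _, hf, hH.2.2⟩
    · rwa [prod_successorWeight]
  · intro f _ _
    exact Γ.prod_successorWeight τ f

theorem card_arcs_le (Γ : WeightedDigraph V) {F : Digraph V} (hF : F ∈ Γ.inForests) :
    F.arcs.card ≤ Fintype.card V - Γ.inForestDim := by
  have h1 := hF.2.card_arcs_add_numTrees_le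
  have h2 : Γ.inForestDim ≤ F.numTrees := Nat.sInf_le ⟨F, hF, rfl⟩
  omega

open Classical in
-- Cutting off at `n - d` loses nothing: an in-forest has at least `d` trees, hence at most `n - d`
-- arcs.
theorem sum_range_setWeight_mul_pow (Γ : WeightedDigraph V) (τ : ℝ) {𝒢 : Set (Digraph V)}
    {𝒢' : ℕ → Set (Digraph V)} (h𝒢 : 𝒢 ⊆ Γ.inForests)
    (h𝒢' : ∀ k F, F ∈ 𝒢' k ↔ F ∈ 𝒢 ∧ F.arcs.card = k) :
    ∑ k ∈ Finset.range (Fintype.card V - Γ.inForestDim + 1), Γ.setWeight (𝒢' k) * τ ^ k =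
      ∑ H : Digraph V with H ∈ 𝒢, Γ.subgraphWeight H * τ ^ H.arcs.card := by
  rw [← Finset.sum_fiberwise_of_maps_to (g := fun H : Digraph V => H.arcs.card)
    (t := Finset.range (Fintype.card V - Γ.inForestDim + 1))]
  · refine Finset.sum_congr rfl fun k _ => ?_
    rw [setWeight, Finset.sum_mul, Finset.filter_filter]
    refine Finset.sum_congr (Finset.filter_congr fun H _ => h𝒢' k H) fun H hH => ?_
    rw [(Finset.mem_filter.1 hH).2.2]
  · intro H hH
    rw [Finset.mem_filter] at hH
    exact Finset.mem_range.2 (Nat.lt_succ_of_le (Γ.card_arcs_le (h𝒢 hH.2)))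

open Classical in
theorem sigmaParam_eq_sum (Γ : WeightedDigraph V) (τ : ℝ) :
    Γ.sigmaParam τ =
      ∑ H : Digraph V with H ∈ Γ.inForests, Γ.subgraphWeight H * τ ^ H.arcs.card :=
  Γ.sum_range_setWeight_mul_pow τ subset_rfl fun _ _ => Iff.rfl

open Classical in
theorem QParam_apply_eq_sum (Γ : WeightedDigraph V) (τ : ℝ) (i j : V) :
    Γ.QParam τ i j =
      ∑ H : Digraph V with H ∈ Γ.inForestsTo i j, Γ.subgraphWeight H * τ ^ H.arcs.card := by
  rw [← Γ.sum_range_setWeight_mul_pow τ (𝒢 := Γ.inForestsTo i j)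
    (𝒢' := fun k => Γ.inForestsCardTo k i j) (fun F hF => hF.1) fun k F => and_right_comm,
    QParam, Matrix.sum_apply]
  refine Finset.sum_congr rfl fun k _ => ?_
  rw [Matrix.smul_apply, smul_eq_mul, mul_comm]
  rfl

theorem sigmaParam_one (Γ : WeightedDigraph V) : Γ.sigmaParam 1 = Γ.sigma := by
  simp [sigmaParam_eq_sum, sigma, setWeight]

theorem QParam_one (Γ : WeightedDigraph V) : Γ.QParam 1 = Γ.Q := by
  ext i j
  simp [QParam_apply_eq_sum, Q, setWeight]

theorem sigmaParam_pos (Γ : WeightedDigraph V) {τ : ℝ} (hτ : 0 ≤ τ) : 0 < Γ.sigmaParam τ := by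
  classical
  rw [sigmaParam_eq_sum]
  -- The arcless forest contributes a positive term even at `τ = 0`.
  have hbot : Digraph.ofSuccessor (fun _ : V => none) ∈ Γ.inForests := by
    refine ⟨fun u v h => ?_, Digraph.isConvergingForest_ofSuccessor fun v =>
      ⟨v, Relation.ReflTransGen.refl, rfl⟩⟩
    cases h
  refine Finset.sum_pos' (fun H hH => ?_) ⟨_, Finset.mem_filter.2 ⟨Finset.mem_univ _, hbot⟩, ?_⟩
  · exact mul_nonneg (Γ.subgraphWeight_pos (Finset.mem_filter.1 hH).2.1).le (pow_nonneg hτ _)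
  · rw [Digraph.card_arcs_ofSuccessor]
    simpa using Γ.subgraphWeight_pos hbot.1

/-! ### Determinant, adjugate and inverse of `I + τL` -/

variable [DecidableEq V]

theorem one_add_smul_laplacian (Γ : WeightedDigraph V) (τ : ℝ) :
    1 + τ • Γ.laplacian =
      Matrix.of fun i => ∑ o, Γ.successorWeight τ i o • successorRow i o := by
  ext i j
  have hw : Γ.weight i i = 0 := Γ.weight_eq_zero i i (Γ.not_adj_self i)
  simp only [Matrix.add_apply, Matrix.smul_apply, laplacian, Matrix.of_apply, Finset.sum_apply,
    Fintype.sum_option, Pi.smul_apply, Pi.add_apply, successorWeight, successorRow, Option.elim,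
    smul_eq_mul, Pi.sub_apply, mul_sub, Finset.sum_sub_distrib, Matrix.one_apply,
    Pi.single_apply, mul_ite, mul_one, mul_zero, Finset.sum_ite_eq, Finset.mem_univ, if_true]
  rcases eq_or_ne i j with rfl | hij
  · rw [if_pos rfl, if_pos rfl, Finset.sum_erase _ hw, hw]
    simp [Finset.mul_sum]
  · simp [hij, hij.symm]

theorem det_one_add_smul_laplacian (Γ : WeightedDigraph V) (τ : ℝ) :
    (1 + τ • Γ.laplacian).det = Γ.sigmaParam τ := by
  classical
  have h := Γ.sum_inForests_eq τ (𝒢 := Γ.inForests) (P := fun _ => True) fun F =>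
    (iff_of_eq (and_true _)).symm
  rw [one_add_smul_laplacian, det_sum_successorRow, sigmaParam_eq_sum]
  rw [h, Finset.sum_filter]
  simp only [and_true, det_successorMatrix, mul_ite, mul_one, mul_zero]
  convert rfl

theorem adjugate_one_add_smul_laplacian (Γ : WeightedDigraph V) (τ : ℝ) :
    (1 + τ • Γ.laplacian).adjugate = Γ.QParam τ := by
  classical
  ext i j
  have h := Γ.sum_inForests_eq τ (𝒢 := Γ.inForestsTo i j)
    (P := fun F => F.InTreeConvergingTo i j) fun F => Iff.rfl
  rw [one_add_smul_laplacian, adjugate_sum_successorRow _ _ _ rfl, QParam_apply_eq_sum]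
  refine Eq.trans ?_ h.symm
  simp only [Digraph.inTreeConvergingTo_ofSuccessor]
  rw [Finset.sum_filter, Finset.sum_filter]
  refine Finset.sum_congr (Finset.ext fun f => by simp only [Finset.mem_univ]) fun f _ => ?_
  by_cases hj : f j = none
  · simp [hj, adjugate_successorMatrix]
  · simp [hj]

theorem isUnit_and_JParam_eq_inv (Γ : WeightedDigraph V) {τ : ℝ} (hτ : 0 ≤ τ) :
    Γ.sigmaParam τ ≠ 0 ∧ IsUnit (1 + τ • Γ.laplacian) ∧
      Γ.JParam τ = (1 + τ • Γ.laplacian)⁻¹ := by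
  have h := (Γ.sigmaParam_pos hτ).ne'
  refine ⟨h, ?_, ?_⟩
  · rw [Matrix.isUnit_iff_isUnit_det, det_one_add_smul_laplacian]
    exact h.isUnit
  · rw [Matrix.inv_def, adjugate_one_add_smul_laplacian, det_one_add_smul_laplacian,
      Ring.inverse_eq_inv', JParam]

end WeightedDigraph

theorem theorem3 {V : Type*} [Fintype V] [DecidableEq V] (Γ : WeightedDigraph V) :
    (Γ.Q = (1 + Γ.laplacian).adjugate ∧
      Γ.sigma = (1 + Γ.laplacian).det ∧
      Γ.sigma ≠ 0 ∧ IsUnit (1 + Γ.laplacian) ∧ Γ.J = (1 + Γ.laplacian)⁻¹) ∧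
    (∀ τ : ℝ,
      Γ.QParam τ = (1 + τ • Γ.laplacian).adjugate ∧
      Γ.sigmaParam τ = (1 + τ • Γ.laplacian).det) ∧
    (∀ τ : ℝ, 0 ≤ τ →
      Γ.sigmaParam τ ≠ 0 ∧ IsUnit (1 + τ • Γ.laplacian) ∧
      Γ.JParam τ = (1 + τ • Γ.laplacian)⁻¹) := by
  refine ⟨?_, fun τ => ⟨(Γ.adjugate_one_add_smul_laplacian τ).symm,
    (Γ.det_one_add_smul_laplacian τ).symm⟩, fun τ hτ => Γ.isUnit_and_JParam_eq_inv hτ⟩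
  have h1 := Γ.adjugate_one_add_smul_laplacian 1
  have h2 := Γ.det_one_add_smul_laplacian 1
  have h3 := Γ.isUnit_and_JParam_eq_inv zero_le_one
  rw [WeightedDigraph.JParam] at h3
  rw [one_smul, WeightedDigraph.QParam_one] at h1
  rw [one_smul, WeightedDigraph.sigmaParam_one] at h2
  rw [one_smul, WeightedDigraph.sigmaParam_one, WeightedDigraph.QParam_one] at h3
  exact ⟨h1.symm, h2.symm, h3⟩
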